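/- Notation. For a vector $x\in\mathbb C^d$ and an integer $s\ge 1$, $x_s$ denotes a vector obtained from $x$ by keeping $s$ components that are largest in magnitude and setting the others to zero (ties broken arbitrarily; $x_s=x$ if $s\ge d$). For $A\in\mathbb C^{m\times d}$, $A_T$ is the submatrix of the columns indexed by $T$, and $\|A\|_2^{(s)}$ is the largest spectral norm of an $s$-column submatrix of $A$ (it is $\|A\|_2$ if $s>d$). The restricted isometry constant $\delta_s$ of $A$ is the least $\delta\ge 0$ such that $(1-\delta)\|z\|_2^2\le\|Az\|_2^2\le(1+\delta)\|z\|_2^2$ for all $z$ with at most $s$ nonzero components. For $A,\Phi\in\mathbb C^{m\times d}$ put $$\varepsilon_A^{(s)}=\frac{\|A-\Phi\|_2^{(s)}}{\|A\|_2^{(s)}},\quad \kappa_A^{(s)}=\frac{\sqrt{1+\delta_s}}{\sqrt{1-\delta_s}},\quad \alpha_s=\frac{\|x-x_s\|_2}{\|x_s\|_2},\quad \beta_s=\frac{\|x-x_s\|_1}{\sqrt s\,\|x_s\|_2}$$ (with $\delta_s$ the constant of $A$, and with $\alpha_s=\beta_s=0$ if $x=0$). CoSaMP with matrix $\Phi$,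 samples $y$ and sparsity level $s$ starts from $a^0=0$ and computes $a^{k+1}$ from $a^k$ as follows: $v=y-\Phi a^k$; $u=\Phi^*v$; $T=\operatorname{supp}(u_{2s})\cup\operatorname{supp}(a^k)$; $w|_T=\Phi_T^\dagger y$ and $w|_{T^c}=0$, where $\dagger$ is the Moore–Penrose pseudoinverse; $a^{k+1}=w_s$. Theorem. There are an absolute constant $C>0$ and a function $N:\mathbb N\to\mathbb N$ such that the following holds for all $m,d\ge 0$, $s\ge 1$, all $A,\Phi\in\mathbb C^{m\times d}$, $x\in\mathbb C^d$, $e\in\mathbb C^m$. Suppose that $$\delta_{4s}\le\frac{1.1}{\bigl(1+\varepsilon_A^{(4s)}\bigr)^2}-1\qquad\text{and}\qquad \alpha_s+\beta_s\le\frac{1}{2\kappa_A^{(s)}} ,$$ where $\delta_{4s}$ is the restricted isometry constant of $A$. Let $b=Ax$ and $y=b+e$, and let $x^\sharp=a^k$ be the output of CoSaMP with decoding matrix $\Phi$ (instead of $A$), samples $y$ and sparsity level $s$, halted after any number $k\ge N(s)$ of iterations. Then $$\|x^\sharp-x\|_2\le C\Bigl(\|x-x_s\|_2+\tfrac1{\sqrt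 s}\|x-x_s\|_1+\bigl(\|A-\Phi\|_2\,\alpha_s+\|A-\Phi\|_2^{(s)}\bigr)\|b\|_2+\|e\|_2\Bigr).$$ -/

import Mathlib

open scoped Matrix

namespace MixedCoSaMP

noncomputable section

open Classical in
/-- The support of a vector. -/
def supp {d : ℕ} (x : EuclideanSpace ℂ (Fin d)) : Finset (Fin d) :=
  Finset.univ.filter fun i => x i ≠ 0

/-- The `ℓ₁` norm. -/
def l1Norm {d : ℕ} (x : EuclideanSpace ℂ (Fin d)) : ℝ := ∑ i, ‖x i‖

/-- `A` satisfies the restricted isometry property with parameters `(s, δ)`. -/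
def RIP {m d : ℕ} (A : Matrix (Fin m) (Fin d) ℂ) (s : ℕ) (δ : ℝ) : Prop :=
  ∀ x : EuclideanSpace ℂ (Fin d), (supp x).card ≤ s →
    (1 - δ) * ‖x‖ ^ 2 ≤ ‖Matrix.toEuclideanLin A x‖ ^ 2 ∧
      ‖Matrix.toEuclideanLin A x‖ ^ 2 ≤ (1 + δ) * ‖x‖ ^ 2

/-- The restricted isometry constant `δ_s` of `A`: the least `δ ≥ 0` for which `A` satisfies the
restricted isometry property with parameters `(s, δ)`. The set below is closed and non-empty, so
the infimum is attained. -/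
def ric {m d : ℕ} (A : Matrix (Fin m) (Fin d) ℂ) (s : ℕ) : ℝ :=
  sInf {δ : ℝ | 0 ≤ δ ∧ RIP A s δ}

/-- The submatrix `A_T` of the columns of `A` indexed by `T`. -/
def cols {m d : ℕ} (A : Matrix (Fin m) (Fin d) ℂ) (T : Finset (Fin d)) :
    Matrix (Fin m) {i // i ∈ T} ℂ :=
  A.submatrix id fun i => i.1

open scoped Matrix.Norms.L2Operator in
/-- The spectral norm `‖A‖₂` of a matrix. -/
def specNorm {m n : Type*} [Fintype m] [Fintype n] [DecidableEq n] (A : Matrix m n ℂ) : ℝ := ‖A‖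

/-- `‖A‖₂^{(s)}`, the largest spectral norm over all `s`-column submatrices of `A`. The spectral
norm does not decrease when columns are added, so allowing fewer columns changes nothing when
`s ≤ d`; when `s > d` the value is `‖A‖₂`. -/
def specNormCols {m d : ℕ} (A : Matrix (Fin m) (Fin d) ℂ) (s : ℕ) : ℝ :=
  ⨆ T : {T : Finset (Fin d) // T.card ≤ s}, specNorm (cols A T.1)

/-- The relative perturbation `ε_A^{(s)} = ‖A - Φ‖₂^{(s)} / ‖A‖₂^{(s)}`. -/
def relPert {m d : ℕ} (A Φ : Matrix (Fin m) (Fin d) ℂ) (s : ℕ) : ℝ :=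
  specNormCols (A - Φ) s / specNormCols A s

/-- `κ_A^{(s)} = √(1 + δ_s) / √(1 - δ_s)`. -/
def kappa {m d : ℕ} (A : Matrix (Fin m) (Fin d) ℂ) (s : ℕ) : ℝ :=
  √(1 + ric A s) / √(1 - ric A s)

/-- `xs` is obtained from `x` by keeping `s` components that are largest in magnitude and setting
the others to zero (ties are broken arbitrarily; if `s ≥ d` everything is kept). -/
def IsLargestPart {d : ℕ} (s : ℕ) (x xs : EuclideanSpace ℂ (Fin d)) : Prop :=
  ∃ S : Finset (Fin d), S.card = min s d ∧ (∀ i ∈ S, ∀ j ∉ S, ‖x j‖ ≤ ‖x i‖) ∧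
    (∀ i ∈ S, xs i = x i) ∧ ∀ i ∉ S, xs i = 0

/-- `α_s = ‖x - x_s‖₂ / ‖x_s‖₂`, as a function of `x` and `x_s`. -/
def alpha {d : ℕ} (x xs : EuclideanSpace ℂ (Fin d)) : ℝ := ‖x - xs‖ / ‖xs‖

/-- `β_s = ‖x - x_s‖₁ / (√s ‖x_s‖₂)`, as a function of `s`, `x` and `x_s`. -/
def beta {d : ℕ} (s : ℕ) (x xs : EuclideanSpace ℂ (Fin d)) : ℝ :=
  l1Norm (x - xs) / (√(s : ℝ) * ‖xs‖)

/-- `B` is the Moore–Penrose pseudoinverse of `M` (the four Penrose equations). -/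
structure IsPinv {m n : Type*} [Fintype m] [Fintype n] (M : Matrix m n ℂ) (B : Matrix n m ℂ) :
    Prop where
  mul_mul_self : M * B * M = M
  mul_mul_inv : B * M * B = B
  left_herm : (M * B)ᴴ = M * B
  right_herm : (B * M)ᴴ = B * M

open scoped ComplexOrder in
theorem exists_isPinv {m n : Type*} [Fintype m] [Fintype n] [DecidableEq n] (M : Matrix m n ℂ) :
    ∃ B : Matrix n m ℂ, IsPinv M B := by
  have hH : (Mᴴ * M).IsHermitian := Matrix.isHermitian_conjTranspose_mul_self M
  -- a Hermitian generalized inverse of `Mᴴ * M` that commutes with it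
  obtain ⟨G, hG, hc, h1, h2⟩ : ∃ G : Matrix n n ℂ, Gᴴ = G ∧ (Mᴴ * M) * G = G * (Mᴴ * M) ∧
      (Mᴴ * M) * G * (Mᴴ * M) = Mᴴ * M ∧ G * (Mᴴ * M) * G = G := by
    set U : Matrix n n ℂ := (hH.eigenvectorUnitary : Matrix n n ℂ) with hU
    have hUU : Uᴴ * U = 1 := by
      simpa [Matrix.star_eq_conjTranspose] using
        Unitary.coe_star_mul_self hH.eigenvectorUnitary
    set D : n → ℂ := fun i => (hH.eigenvalues i : ℂ) with hD
    have hspec : Mᴴ * M = U * Matrix.diagonal D * Uᴴ := by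
      have := hH.spectral_theorem
      rw [Unitary.conjStarAlgAut_apply] at this
      exact this
    have key : ∀ X Y : Matrix n n ℂ, (U * X * Uᴴ) * (U * Y * Uᴴ) = U * (X * Y) * Uᴴ := by
      intro X Y
      calc (U * X * Uᴴ) * (U * Y * Uᴴ) = U * X * (Uᴴ * U) * Y * Uᴴ := by
            simp only [Matrix.mul_assoc]
        _ = _ := by rw [hUU]; simp only [Matrix.mul_assoc, Matrix.one_mul]
    refine ⟨U * Matrix.diagonal (fun i => (D i)⁻¹) * Uᴴ, ?_, ?_, ?_, ?_⟩
    · simp only [Matrix.conjTranspose_mul, Matrix.conjTranspose_conjTranspose,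
        Matrix.diagonal_conjTranspose, Matrix.mul_assoc]
      congr 3
      ext i
      simp [hD]
    · rw [hspec, key, key]
      simp [Matrix.diagonal_mul_diagonal, mul_comm]
    · rw [hspec, key, key]
      simp [Matrix.diagonal_mul_diagonal]
    · rw [hspec, key, key]
      congr 2
      simp only [Matrix.diagonal_mul_diagonal]
      congr 1
      ext i
      by_cases h : D i = 0 <;> simp [h]
  have h3 : M * (G * (Mᴴ * M)) = M := by
    have h0 : Mᴴ * M * (G * (Mᴴ * M) - 1) = 0 := by
      rw [Matrix.mul_sub, ← Matrix.mul_assoc, h1, Matrix.mul_one, sub_self]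
    have := (Matrix.conjTranspose_mul_self_mul_eq_zero M _).1 h0
    rw [Matrix.mul_sub, Matrix.mul_one, sub_eq_zero] at this
    exact this
  refine ⟨G * Mᴴ, ?_, ?_, ?_, ?_⟩
  · simpa only [Matrix.mul_assoc] using h3
  · have := congrArg (· * Mᴴ) h2
    simpa only [Matrix.mul_assoc] using this
  · simp only [Matrix.conjTranspose_mul, Matrix.conjTranspose_conjTranspose, hG, Matrix.mul_assoc]
  · rw [Matrix.mul_assoc, Matrix.conjTranspose_mul, hG, hH.eq, hc]

/-- The Moore–Penrose pseudoinverse `M†`. -/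
def pinv {m n : Type*} [Fintype m] [Fintype n] [DecidableEq n] (M : Matrix m n ℂ) :
    Matrix n m ℂ :=
  (exists_isPinv M).choose

theorem isPinv_pinv {m n : Type*} [Fintype m] [Fintype n] [DecidableEq n] (M : Matrix m n ℂ) :
    IsPinv M (pinv M) :=
  (exists_isPinv M).choose_spec

/-- `w|_T = Φ_T† y` and `w|_{Tᶜ} = 0`. -/
def IsEstimate {m d : ℕ} (Φ : Matrix (Fin m) (Fin d) ℂ) (y : EuclideanSpace ℂ (Fin m))
    (T : Finset (Fin d)) (w : EuclideanSpace ℂ (Fin d)) : Prop :=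
  (∀ i : {i // i ∈ T}, w i.1 = (pinv (cols Φ T) *ᵥ y.ofLp) i) ∧ ∀ i ∉ T, w i = 0

/-- One iteration of CoSaMP with matrix `Φ`, samples `y` and sparsity level `s` can lead from the
approximation `a` to the approximation `a'`. -/
def IsStep {m d : ℕ} (Φ : Matrix (Fin m) (Fin d) ℂ) (y : EuclideanSpace ℂ (Fin m)) (s : ℕ)
    (a a' : EuclideanSpace ℂ (Fin d)) : Prop :=
  ∃ v : EuclideanSpace ℂ (Fin m), ∃ u u' w : EuclideanSpace ℂ (Fin d),
    v = y - Matrix.toEuclideanLin Φ a ∧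
    u = Matrix.toEuclideanLin Φᴴ v ∧
    IsLargestPart (2 * s) u u' ∧
    IsEstimate Φ y (supp u' ∪ supp a) w ∧
    IsLargestPart s w a'

/-- `a 0, a 1, a 2, …` are the successive approximations of a run of CoSaMP with matrix `Φ`,
samples `y` and sparsity level `s`. -/
def IsRun {m d : ℕ} (Φ : Matrix (Fin m) (Fin d) ℂ) (y : EuclideanSpace ℂ (Fin m)) (s : ℕ)
    (a : ℕ → EuclideanSpace ℂ (Fin d)) : Prop :=
  a 0 = 0 ∧ ∀ k, IsStep Φ y s (a k) (a (k + 1))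

end

end MixedCoSaMP

/-! Decoding with the wrong matrix is decoding with the right one under more noise: `A x + e = Φ xs
+ e'` with `e' = A (x - xs) + (A - Φ) xs + e`. It is enough to analyse CoSaMP for `Φ` on the sparse
target `xs`, and then to bound `‖e'‖`.

The hypothesis on `δ_{4s}` says that `√(1 + δ) (1 + ε) ≤ √1.1`, which makes `Φ` satisfy the RIP of
order `4s` with constant `0.1` (`rip_of_relPert`). One iteration then contracts, up to noise, the
part of the target that the merged support `T` misses (`IsStep.exists_bounds`). This missed part is
the restriction of the target to a subset of its support, so its norm takes at most `2 ^ s` values.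
It decreases strictly while above a multiple of the noise, so it reaches that level after a number
of iterations depending on `s` alone, whatever the dynamic range of the target
(`le_of_contract_of_finite_range`, `IsRun.norm_sub_le`).

In `e'`, the tail `A (x - xs)` is bounded by the energy estimate `RIP.norm_le_add_l1Norm`. The term
`(A - Φ) xs` is at most `‖A - Φ‖₂^{(s)} ‖xs‖`, and the bound on `α_s + β_s` keeps `A (x - xs)` below
half the size guaranteed for `A xs`, whence `‖xs‖ ≤ 2.2 ‖b‖` (`norm_largestPart_le`). -/

namespace MixedCoSaMP

/-! ### Contraction with finitely many values -/

section Sequence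

/-- A sequence which contracts up to an additive error and takes only few values is soon small. -/
theorem le_of_contract_of_finite_range {M : ℕ → ℝ} {c : ℝ} (hc : 0 ≤ c)
    (hM : ∀ k, M (k + 1) ≤ M k / 2 + c) (F : Finset ℝ) (hF : ∀ k, M k ∈ F) {n : ℕ}
    (hn : F.card ≤ n) {k : ℕ} (hk : n ≤ k) : M k ≤ 4 * c := by
  by_contra! hlt
  have hback : ∀ j ≤ k, 4 * c < M j := by
    intro j hj
    by_contra! hle
    -- The region below `4 * c` is absorbing, since `4c / 2 + c ≤ 4c`.
    have : ∀ i, j ≤ i → M i ≤ 4 * c := by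
      intro i hi
      induction i, hi using Nat.le_induction with
      | base => exact hle
      | succ i _ ih => linarith [hM i]
    linarith [this k hj]
  have hlt' : ∀ i j, i < j → j ≤ k → M j < M i := by
    intro i j hij
    induction j, hij using Nat.le_induction with
    | base => intro h; linarith [hM i, hback i (by omega)]
    | succ j hj ih => intro h; linarith [hM j, hback j (by omega), ih (by omega)]
  -- Pigeonhole: `k + 1` distinct values cannot fit in `F`, which has at most `n ≤ k` elements.
  have hinj : Set.InjOn M (Finset.range (k + 1) : Set ℕ) := by
    intro i hi j hj hij
    simp only [Finset.coe_range, Set.mem_Iio] at hi hj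
    rcases lt_trichotomy i j with h | h | h
    · exact absurd hij (hlt' i j h (by omega)).ne'
    · exact h
    · exact absurd hij (hlt' j i h (by omega)).ne
  have := Finset.card_le_card_of_injOn M (fun i _ => hF i) hinj
  rw [Finset.card_range] at this
  omega

end Sequence

/-! ### Sets of largest entries -/

section Dominating

/-- The common part cancels; `R \ S` is no larger than `S \ R`, and each of its terms is at most
each term there. -/
theorem sum_le_sum_of_dominating {ι : Type*} [DecidableEq ι] {f : ι → ℝ} (hf : ∀ i, 0 ≤ f i)
    {R S : Finset ι} (hcard : R.card ≤ S.card) (hS : ∀ i ∈ S, ∀ j ∉ S, f j ≤ f i) :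
    ∑ i ∈ R, f i ≤ ∑ i ∈ S, f i := by
  have h1 : ∑ i ∈ R \ S, f i ≤ ∑ i ∈ S \ R, f i := by
    rcases (R \ S).eq_empty_or_nonempty with h | h
    · rw [h, Finset.sum_empty]
      exact Finset.sum_nonneg fun i _ => hf i
    · obtain ⟨j, hj, hmax⟩ := Finset.exists_max_image _ f h
      have hc : (R \ S).card ≤ (S \ R).card := by
        have h1 := Finset.card_sdiff_add_card_inter R S
        have h2 := Finset.card_sdiff_add_card_inter S R
        rw [Finset.inter_comm] at h2
        omega
      calc ∑ i ∈ R \ S, f i ≤ (R \ S).card • f j := Finset.sum_le_card_nsmul _ _ _ hmax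
        _ ≤ (S \ R).card • f j := nsmul_le_nsmul_left (hf j) hc
        _ ≤ ∑ i ∈ S \ R, f i := Finset.card_nsmul_le_sum _ _ _ fun i hi =>
            hS i (Finset.mem_sdiff.1 hi).1 j (Finset.mem_sdiff.1 hj).2
  rw [← Finset.sum_sdiff (Finset.inter_subset_left : R ∩ S ⊆ R),
    ← Finset.sum_sdiff (Finset.inter_subset_left : S ∩ R ⊆ S), Finset.sdiff_inter_self_left,
    Finset.sdiff_inter_self_left, Finset.inter_comm S R]
  gcongr

theorem exists_dominating {ι : Type*} [Fintype ι] [DecidableEq ι] (f : ι → ℝ) (n : ℕ)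
    (hn : n ≤ Fintype.card ι) :
    ∃ S : Finset ι, S.card = n ∧ ∀ i ∈ S, ∀ j ∉ S, f j ≤ f i := by
  induction n with
  | zero => exact ⟨∅, by simp⟩
  | succ n ih =>
    obtain ⟨S, hS, hdom⟩ := ih (by omega)
    have hne : Sᶜ.Nonempty := by
      rw [← Finset.card_pos, Finset.card_compl]
      omega
    obtain ⟨j, hj, hmax⟩ := Finset.exists_max_image _ f hne
    rw [Finset.mem_compl] at hj
    refine ⟨insert j S, by rw [Finset.card_insert_of_notMem hj, hS], ?_⟩
    intro i hi l hl
    simp only [Finset.mem_insert, not_or] at hi hl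
    rcases hi with rfl | hi
    · exact hmax l (Finset.mem_compl.2 hl.2)
    · exact hdom i hi l hl.2

end Dominating

/-! ### Supports and coordinate restrictions -/

section Restrict

variable {d : ℕ}

theorem mem_supp {x : EuclideanSpace ℂ (Fin d)} {i : Fin d} : i ∈ supp x ↔ x i ≠ 0 := by
  simp [supp]

theorem supp_subset_iff {x : EuclideanSpace ℂ (Fin d)} {T : Finset (Fin d)} :
    supp x ⊆ T ↔ ∀ i ∉ T, x i = 0 := by
  refine ⟨fun h i hi => ?_, fun h i hi => ?_⟩
  · by_contra hx
    exact hi (h (mem_supp.2 hx))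
  · by_contra hT
    exact mem_supp.1 hi (h i hT)

theorem supp_neg (x : EuclideanSpace ℂ (Fin d)) : supp (-x) = supp x := by
  ext i
  simp only [mem_supp, PiLp.neg_apply, ne_eq, neg_eq_zero]

/-- The restriction of a vector to a set of coordinates. -/
noncomputable def restr (T : Finset (Fin d)) :
    EuclideanSpace ℂ (Fin d) →ₗ[ℂ] EuclideanSpace ℂ (Fin d) where
  toFun x := WithLp.toLp 2 fun i => if i ∈ T then x i else 0
  map_add' x y := by ext i; by_cases h : i ∈ T <;> simp [h]
  map_smul' c x := by ext i; by_cases h : i ∈ T <;> simp [h]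

theorem restr_apply (T : Finset (Fin d)) (x : EuclideanSpace ℂ (Fin d)) (i : Fin d) :
    restr T x i = if i ∈ T then x i else 0 := rfl

theorem restr_of_mem {T : Finset (Fin d)} (x : EuclideanSpace ℂ (Fin d)) {i : Fin d}
    (hi : i ∈ T) : restr T x i = x i := if_pos hi

theorem restr_of_notMem {T : Finset (Fin d)} (x : EuclideanSpace ℂ (Fin d)) {i : Fin d}
    (hi : i ∉ T) : restr T x i = 0 := if_neg hi

theorem supp_restr_subset (T : Finset (Fin d)) (x : EuclideanSpace ℂ (Fin d)) :
    supp (restr T x) ⊆ T :=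
  supp_subset_iff.2 fun _ hi => restr_of_notMem x hi

theorem supp_add_subset (x y : EuclideanSpace ℂ (Fin d)) : supp (x + y) ⊆ supp x ∪ supp y := by
  rw [supp_subset_iff]
  intro i hi
  simp only [Finset.mem_union, mem_supp, not_or, not_not] at hi
  simp [hi]

theorem supp_sub_subset (x y : EuclideanSpace ℂ (Fin d)) : supp (x - y) ⊆ supp x ∪ supp y := by
  rw [supp_subset_iff]
  intro i hi
  simp only [Finset.mem_union, mem_supp, not_or, not_not] at hi
  simp [hi]

theorem supp_smul_subset (c : ℂ) (x : EuclideanSpace ℂ (Fin d)) : supp (c • x) ⊆ supp x := by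
  rw [supp_subset_iff]
  intro i hi
  simp only [mem_supp, not_not] at hi
  simp [hi]

theorem norm_sq_restr (T : Finset (Fin d)) (x : EuclideanSpace ℂ (Fin d)) :
    ‖restr T x‖ ^ 2 = ∑ i ∈ T, ‖x i‖ ^ 2 := by
  rw [EuclideanSpace.norm_sq_eq, ← Finset.sum_subset (Finset.subset_univ T)]
  · exact Finset.sum_congr rfl fun i hi => by rw [restr_of_mem x hi]
  · intro i _ hi
    simp [restr_of_notMem x hi]

theorem restr_add_restr_compl (T : Finset (Fin d)) (x : EuclideanSpace ℂ (Fin d)) :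
    restr T x + restr Tᶜ x = x := by
  ext i
  by_cases h : i ∈ T <;> simp [restr_apply, h]

theorem inner_restr_left (T : Finset (Fin d)) (x : EuclideanSpace ℂ (Fin d)) :
    inner ℂ (restr T x) x = ((‖restr T x‖ ^ 2 : ℝ) : ℂ) := by
  have : inner ℂ (restr T x) x = inner ℂ (restr T x) (restr T x) := by
    simp only [PiLp.inner_apply]
    refine Finset.sum_congr rfl fun i _ => ?_
    by_cases h : i ∈ T <;> simp [restr_apply, h]
  rw [this, inner_self_eq_norm_sq_to_K]
  norm_cast

theorem inner_eq_zero_of_disjoint {x y : EuclideanSpace ℂ (Fin d)}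
    (h : ∀ i, x i = 0 ∨ y i = 0) : inner ℂ x y = 0 := by
  rw [PiLp.inner_apply]
  refine Finset.sum_eq_zero fun i _ => ?_
  rcases h i with h | h <;> simp [h]

theorem restr_eq_self {T : Finset (Fin d)} {x : EuclideanSpace ℂ (Fin d)} (h : supp x ⊆ T) :
    restr T x = x := by
  ext i
  by_cases hi : i ∈ T
  · exact restr_of_mem x hi
  · rw [restr_of_notMem x hi, supp_subset_iff.1 h i hi]

end Restrict

/-! ### Best sparse approximation -/

section LargestPart

variable {d s : ℕ} {x xs : EuclideanSpace ℂ (Fin d)}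

theorem IsLargestPart.card_supp_le (h : IsLargestPart s x xs) : (supp xs).card ≤ s := by
  obtain ⟨S, hS, -, -, h0⟩ := h
  exact (Finset.card_le_card (supp_subset_iff.2 h0)).trans (hS.le.trans (min_le_left _ _))

/-- CoSaMP uses the support of the truncated vector, which can be smaller than the selected set;
only zero entries are lost. -/
theorem IsLargestPart.eq_restr (h : IsLargestPart s x xs) : xs = restr (supp xs) x := by
  obtain ⟨S, -, -, h1, h0⟩ := h
  ext i
  by_cases hi : i ∈ supp xs
  · rw [restr_of_mem x hi, h1 i]
    by_contra hS
    exact mem_supp.1 hi (h0 i hS)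
  · rw [restr_of_notMem x hi]
    simpa [mem_supp] using hi

theorem IsLargestPart.sum_le (h : IsLargestPart s x xs) {R : Finset (Fin d)} (hR : R.card ≤ s) :
    ∑ i ∈ R, ‖x i‖ ^ 2 ≤ ‖xs‖ ^ 2 := by
  obtain ⟨S, hS, hdom, h1, h0⟩ := h
  have hx : xs = restr S x := by
    ext i
    by_cases hi : i ∈ S
    · rw [restr_of_mem x hi, h1 i hi]
    · rw [restr_of_notMem x hi, h0 i hi]
  rw [hx, norm_sq_restr]
  refine sum_le_sum_of_dominating (fun _ => by positivity) ?_ fun i hi j hj => ?_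
  · rw [hS]
    exact le_min hR (by simpa using Finset.card_le_univ R)
  · have := hdom i hi j hj
    gcongr

theorem norm_sq_restr_add_compl (T : Finset (Fin d)) (x : EuclideanSpace ℂ (Fin d)) :
    ‖restr T x‖ ^ 2 + ‖restr Tᶜ x‖ ^ 2 = ‖x‖ ^ 2 := by
  rw [norm_sq_restr, norm_sq_restr, EuclideanSpace.norm_sq_eq, Finset.sum_add_sum_compl]

theorem norm_restr_le (T : Finset (Fin d)) (x : EuclideanSpace ℂ (Fin d)) :
    ‖restr T x‖ ≤ ‖x‖ := by
  have := norm_sq_restr_add_compl T x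
  exact (abs_le_of_sq_le_sq' (by linarith [sq_nonneg ‖restr Tᶜ x‖]) (norm_nonneg _)).2

/-- The largest part is a best sparse approximation. -/
theorem IsLargestPart.norm_sub_le (h : IsLargestPart s x xs) {z : EuclideanSpace ℂ (Fin d)}
    (hz : (supp z).card ≤ s) : ‖x - xs‖ ≤ ‖x - z‖ := by
  have h1 : x - xs = restr (supp xs)ᶜ x := by
    conv_lhs => rw [h.eq_restr]
    rw [sub_eq_iff_eq_add', restr_add_restr_compl]
  have h2 : restr (supp z)ᶜ (x - z) = restr (supp z)ᶜ x := by
    ext i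
    by_cases hi : i ∈ supp z
    · simp [restr_apply, hi]
    · have : z i = 0 := by simpa [mem_supp] using hi
      simp [restr_apply, this]
  have h3 := norm_sq_restr_add_compl (supp xs) x
  have h4 := norm_sq_restr_add_compl (supp z) x
  have h5 := h.sum_le hz
  rw [← norm_sq_restr] at h5
  rw [← h.eq_restr, ← h1] at h3
  have h6 := norm_restr_le (supp z)ᶜ (x - z)
  rw [h2] at h6
  refine le_trans (abs_le_of_sq_le_sq' ?_ (norm_nonneg _)).2 h6
  linarith

end LargestPart

/-! ### Restricted isometry and inner products -/

section RIP

variable {m d s : ℕ} {A : Matrix (Fin m) (Fin d) ℂ} {δ : ℝ}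

theorem exists_norm_toEuclideanLin_le (A : Matrix (Fin m) (Fin d) ℂ) :
    ∃ K : ℝ, 0 ≤ K ∧ ∀ x, ‖Matrix.toEuclideanLin A x‖ ≤ K * ‖x‖ :=
  ⟨‖(Matrix.toEuclideanLin A).toContinuousLinearMap‖, norm_nonneg _,
    (Matrix.toEuclideanLin A).toContinuousLinearMap.le_opNorm⟩

theorem exists_rip (A : Matrix (Fin m) (Fin d) ℂ) (s : ℕ) : ∃ δ, 0 ≤ δ ∧ RIP A s δ := by
  obtain ⟨K, hK, h⟩ := exists_norm_toEuclideanLin_le A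
  refine ⟨1 + K ^ 2, by positivity, fun x _ => ⟨?_, ?_⟩⟩
  · nlinarith [sq_nonneg ‖Matrix.toEuclideanLin A x‖, mul_nonneg (sq_nonneg K) (sq_nonneg ‖x‖)]
  · have := pow_le_pow_left₀ (norm_nonneg _) (h x) 2
    nlinarith [sq_nonneg ‖x‖]

theorem ric_nonneg (A : Matrix (Fin m) (Fin d) ℂ) (s : ℕ) : 0 ≤ ric A s :=
  Real.sInf_nonneg fun _ h => h.1

/-- For each fixed vector the two inequalities are lower bounds on `δ`, and these pass to the
infimum. -/
theorem rip_ric (A : Matrix (Fin m) (Fin d) ℂ) (s : ℕ) : RIP A s (ric A s) := by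
  intro x hx
  rcases eq_or_ne x 0 with rfl | h0
  · simp
  have hpos : 0 < ‖x‖ ^ 2 := by positivity
  have hne : {δ : ℝ | 0 ≤ δ ∧ RIP A s δ}.Nonempty := exists_rip A s
  have h1 : 1 - ‖Matrix.toEuclideanLin A x‖ ^ 2 / ‖x‖ ^ 2 ≤ ric A s := by
    refine le_csInf hne fun δ hδ => ?_
    have := (hδ.2 x hx).1
    rw [sub_le_comm, le_div_iff₀ hpos]
    exact this
  have h2 : ‖Matrix.toEuclideanLin A x‖ ^ 2 / ‖x‖ ^ 2 - 1 ≤ ric A s := by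
    refine le_csInf hne fun δ hδ => ?_
    have := (hδ.2 x hx).2
    rw [sub_le_iff_le_add', div_le_iff₀ hpos]
    exact this
  rw [sub_le_comm, le_div_iff₀ hpos] at h1
  rw [sub_le_iff_le_add', div_le_iff₀ hpos] at h2
  exact ⟨h1, h2⟩

theorem ric_mono (A : Matrix (Fin m) (Fin d) ℂ) {s t : ℕ} (h : s ≤ t) : ric A s ≤ ric A t :=
  csInf_le ⟨0, fun _ hδ => hδ.1⟩ ⟨ric_nonneg A t, fun x hx => rip_ric A t x (hx.trans h)⟩

theorem RIP.norm_le (h : RIP A s δ) {x : EuclideanSpace ℂ (Fin d)} (hx : (supp x).card ≤ s) :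
    ‖Matrix.toEuclideanLin A x‖ ≤ √(1 + δ) * ‖x‖ := by
  have := Real.sqrt_le_sqrt (h x hx).2
  rwa [Real.sqrt_sq (norm_nonneg _), Real.sqrt_mul' _ (sq_nonneg _),
    Real.sqrt_sq (norm_nonneg _)] at this

theorem RIP.le_norm (h : RIP A s δ) {x : EuclideanSpace ℂ (Fin d)} (hx : (supp x).card ≤ s) :
    √(1 - δ) * ‖x‖ ≤ ‖Matrix.toEuclideanLin A x‖ := by
  have := Real.sqrt_le_sqrt (h x hx).1
  rwa [Real.sqrt_sq (norm_nonneg _), Real.sqrt_mul' _ (sq_nonneg _),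
    Real.sqrt_sq (norm_nonneg _)] at this

/-- Polarization: the upper bound at `x + y` minus the lower bound at `x - y`. -/
theorem RIP.re_inner_sub_le_sq (h : RIP A s δ) {x y : EuclideanSpace ℂ (Fin d)}
    (hxy : (supp x ∪ supp y).card ≤ s) :
    (inner ℂ (Matrix.toEuclideanLin A x) (Matrix.toEuclideanLin A y)).re - (inner ℂ x y).re ≤
      δ / 2 * (‖x‖ ^ 2 + ‖y‖ ^ 2) := by
  have h1 := (h (x + y) ((Finset.card_le_card (supp_add_subset x y)).trans hxy)).2
  have h2 := (h (x - y) ((Finset.card_le_card (supp_sub_subset x y)).trans hxy)).1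
  rw [map_add] at h1
  rw [map_sub] at h2
  have e1 := norm_add_sq (𝕜 := ℂ) x y
  have e2 := norm_sub_sq (𝕜 := ℂ) x y
  have e3 := norm_add_sq (𝕜 := ℂ) (Matrix.toEuclideanLin A x) (Matrix.toEuclideanLin A y)
  have e4 := norm_sub_sq (𝕜 := ℂ) (Matrix.toEuclideanLin A x) (Matrix.toEuclideanLin A y)
  simp only [RCLike.re_eq_complex_re] at e1 e2 e3 e4
  rw [e1, e3] at h1
  rw [e2, e4] at h2
  linarith

/-- Near-isometries nearly preserve inner products. -/
theorem RIP.re_inner_sub_le (h : RIP A s δ) {x y : EuclideanSpace ℂ (Fin d)}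
    (hxy : (supp x ∪ supp y).card ≤ s) :
    (inner ℂ (Matrix.toEuclideanLin A x) (Matrix.toEuclideanLin A y)).re - (inner ℂ x y).re ≤
      δ * (‖x‖ * ‖y‖) := by
  rcases eq_or_ne x 0 with rfl | hx
  · simp
  rcases eq_or_ne y 0 with rfl | hy
  · simp
  have hx' : 0 < ‖x‖ := norm_pos_iff.2 hx
  have hy' : 0 < ‖y‖ := norm_pos_iff.2 hy
  -- Scaling each vector by the norm of the other equalises the norms, so the mean of squares
  -- becomes the product.
  have hc : (supp ((‖y‖ : ℂ) • x) ∪ supp ((‖x‖ : ℂ) • y)).card ≤ s :=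
    (Finset.card_le_card
      (Finset.union_subset_union (supp_smul_subset _ _) (supp_smul_subset _ _))).trans hxy
  have := h.re_inner_sub_le_sq hc
  rw [map_smul, map_smul, inner_smul_left, inner_smul_right, inner_smul_left, inner_smul_right,
    norm_smul, norm_smul] at this
  simp only [Complex.conj_ofReal, Complex.re_ofReal_mul, Complex.norm_real, norm_norm] at this
  refine le_of_mul_le_mul_left ?_ (mul_pos hx' hy')
  linarith

end RIP

/-! ### Normal equations for the pseudoinverse -/

section LeastSquares

variable {m d : ℕ}

theorem toEuclideanLin_ofLp (A : Matrix (Fin m) (Fin d) ℂ) (x : EuclideanSpace ℂ (Fin d)) :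
    (Matrix.toEuclideanLin A x).ofLp = A *ᵥ x.ofLp := rfl

theorem mulVec_eq_cols_mulVec (A : Matrix (Fin m) (Fin d) ℂ) {T : Finset (Fin d)} {x : Fin d → ℂ}
    (hx : ∀ i ∉ T, x i = 0) : A *ᵥ x = cols A T *ᵥ fun i => x i.1 := by
  ext j
  simp only [Matrix.mulVec, dotProduct, cols, Matrix.submatrix_apply, id]
  rw [← Finset.sum_subset (Finset.subset_univ T) fun i _ hi => by rw [hx i hi, mul_zero],
    ← Finset.sum_coe_sort]

/-- Since `M * B` is Hermitian, the left side is `(M * B * M)ᴴ`. This is the normal equation for `B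
*ᵥ y`. -/
theorem IsPinv.conjTranspose_mul {m n : Type*} [Fintype m] [Fintype n] {M : Matrix m n ℂ}
    {B : Matrix n m ℂ} (h : IsPinv M B) : Mᴴ * (M * B) = Mᴴ := by
  conv_lhs => rw [← h.left_herm, ← Matrix.conjTranspose_mul, h.mul_mul_self]

theorem inner_toEuclideanLin_left (A : Matrix (Fin m) (Fin d) ℂ) (x : EuclideanSpace ℂ (Fin d))
    (y : EuclideanSpace ℂ (Fin m)) :
    inner ℂ (Matrix.toEuclideanLin A x) y = inner ℂ x (Matrix.toEuclideanLin Aᴴ y) := by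
  rw [Matrix.toEuclideanLin_conjTranspose_eq_adjoint, LinearMap.adjoint_inner_right]

/-- The residual of the least-squares estimate is orthogonal to the chosen columns. -/
theorem IsEstimate.inner_residual {Φ : Matrix (Fin m) (Fin d) ℂ} {y : EuclideanSpace ℂ (Fin m)}
    {T : Finset (Fin d)} {w : EuclideanSpace ℂ (Fin d)} (h : IsEstimate Φ y T w)
    {z : EuclideanSpace ℂ (Fin d)} (hz : supp z ⊆ T) :
    inner ℂ (Matrix.toEuclideanLin Φ z) (y - Matrix.toEuclideanLin Φ w) = 0 := by
  rw [inner_toEuclideanLin_left]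
  refine inner_eq_zero_of_disjoint fun i => ?_
  by_cases hi : i ∈ T
  · right
    have hw : (fun i : {i // i ∈ T} => w i.1) = pinv (cols Φ T) *ᵥ y.ofLp := funext h.1
    rw [toEuclideanLin_ofLp, WithLp.ofLp_sub, toEuclideanLin_ofLp, mulVec_eq_cols_mulVec Φ h.2, hw]
    have hn : (cols Φ T)ᴴ *ᵥ (y.ofLp - cols Φ T *ᵥ (pinv (cols Φ T) *ᵥ y.ofLp)) = 0 := by
      rw [Matrix.mulVec_sub, Matrix.mulVec_mulVec, Matrix.mulVec_mulVec, Matrix.mul_assoc,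
        (isPinv_pinv (cols Φ T)).conjTranspose_mul, sub_self]
    exact congrFun hn ⟨i, hi⟩
  · exact Or.inl (supp_subset_iff.1 hz i hi)

end LeastSquares

/-! ### Column-restricted spectral norms -/

section SpectralNorm

variable {m d : ℕ}

open scoped Matrix.Norms.L2Operator in
theorem norm_mulVec_le_specNorm {m n : Type*} [Fintype m] [Fintype n] [DecidableEq n]
    (A : Matrix m n ℂ) (x : n → ℂ) :
    ‖WithLp.toLp 2 (A *ᵥ x)‖ ≤ specNorm A * ‖WithLp.toLp 2 x‖ :=
  Matrix.l2_opNorm_mulVec A (WithLp.toLp 2 x)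

open scoped Matrix.Norms.L2Operator in
theorem specNorm_nonneg {m n : Type*} [Fintype m] [Fintype n] [DecidableEq n]
    (A : Matrix m n ℂ) : 0 ≤ specNorm A := norm_nonneg A

open scoped Matrix.Norms.L2Operator in
theorem specNorm_le {m n : Type*} [Fintype m] [Fintype n] [DecidableEq n]
    {A : Matrix m n ℂ} {c : ℝ} (hc : 0 ≤ c)
    (h : ∀ x : n → ℂ, ‖WithLp.toLp 2 (A *ᵥ x)‖ ≤ c * ‖WithLp.toLp 2 x‖) : specNorm A ≤ c := by
  rw [specNorm, Matrix.l2_opNorm_def]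
  exact ContinuousLinearMap.opNorm_le_bound _ hc fun x => h x.ofLp

theorem specNormCols_nonneg (A : Matrix (Fin m) (Fin d) ℂ) (s : ℕ) : 0 ≤ specNormCols A s :=
  Real.iSup_nonneg fun _ => specNorm_nonneg _

theorem norm_toLp_coe_eq {T : Finset (Fin d)} {x : EuclideanSpace ℂ (Fin d)}
    (hx : ∀ i ∉ T, x i = 0) : ‖WithLp.toLp 2 fun i : {i // i ∈ T} => x i.1‖ = ‖x‖ := by
  rw [EuclideanSpace.norm_eq, EuclideanSpace.norm_eq,
    ← Finset.sum_subset (Finset.subset_univ T) fun i _ hi => by simp [hx i hi],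
    ← Finset.sum_coe_sort T]

theorem norm_le_specNormCols (A : Matrix (Fin m) (Fin d) ℂ) {s : ℕ}
    {x : EuclideanSpace ℂ (Fin d)} (hx : (supp x).card ≤ s) :
    ‖Matrix.toEuclideanLin A x‖ ≤ specNormCols A s * ‖x‖ := by
  have h0 : ∀ i ∉ supp x, x i = 0 := supp_subset_iff.1 subset_rfl
  have h1 : specNorm (cols A (supp x)) ≤ specNormCols A s :=
    le_ciSup (f := fun T : {T : Finset (Fin d) // T.card ≤ s} => specNorm (cols A T.1))
      (Set.finite_range _).bddAbove ⟨supp x, hx⟩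
  have h2 := norm_mulVec_le_specNorm (cols A (supp x)) fun i => x i.1
  rw [← mulVec_eq_cols_mulVec A h0, norm_toLp_coe_eq h0] at h2
  exact h2.trans (by gcongr)

theorem specNormCols_le {A : Matrix (Fin m) (Fin d) ℂ} {s : ℕ} {c : ℝ} (hc : 0 ≤ c)
    (h : ∀ x : EuclideanSpace ℂ (Fin d), (supp x).card ≤ s →
      ‖Matrix.toEuclideanLin A x‖ ≤ c * ‖x‖) : specNormCols A s ≤ c := by
  refine Real.iSup_le (fun T => specNorm_le hc fun g => ?_) hc
  set x : EuclideanSpace ℂ (Fin d) :=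
    WithLp.toLp 2 fun i => if hi : i ∈ T.1 then g ⟨i, hi⟩ else 0 with hxdef
  have h0 : ∀ i ∉ T.1, x i = 0 := fun i hi => by simp [hxdef, hi]
  have hg : g = fun i : {i // i ∈ T.1} => x i.1 := by
    ext i
    simp [hxdef]
  rw [hg, norm_toLp_coe_eq h0, ← mulVec_eq_cols_mulVec A h0]
  exact h x ((Finset.card_le_card (supp_subset_iff.2 h0)).trans T.2)

end SpectralNorm

/-! ### Transfer of the RIP from `A` to `Φ` -/

section Perturbation

variable {m d t : ℕ} {A Φ : Matrix (Fin m) (Fin d) ℂ}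

theorem toEuclideanLin_sub_apply (A Φ : Matrix (Fin m) (Fin d) ℂ) (x : EuclideanSpace ℂ (Fin d)) :
    Matrix.toEuclideanLin (A - Φ) x = Matrix.toEuclideanLin A x - Matrix.toEuclideanLin Φ x := by
  rw [map_sub, LinearMap.sub_apply]

theorem relPert_nonneg (A Φ : Matrix (Fin m) (Fin d) ℂ) (t : ℕ) : 0 ≤ relPert A Φ t :=
  div_nonneg (specNormCols_nonneg _ _) (specNormCols_nonneg _ _)

theorem ric_le_of_relPert (h : ric A t ≤ 1.1 / (1 + relPert A Φ t) ^ 2 - 1) : ric A t ≤ 0.1 := by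
  have h1 : 1 ≤ (1 + relPert A Φ t) ^ 2 := one_le_pow₀ (by linarith [relPert_nonneg A Φ t])
  have h2 := div_le_self (by norm_num : (0 : ℝ) ≤ 1.1) h1
  linarith

/-- The denominator of `relPert` must not vanish, or the quotient would be the default `0`; the
lower RIP bound at a basis vector ensures this, which requires `d > 0`. -/
theorem norm_sub_apply_le_relPert [NeZero d] (ht : 1 ≤ t) (hA : ric A t < 1)
    {x : EuclideanSpace ℂ (Fin d)} (hx : (supp x).card ≤ t) :
    ‖Matrix.toEuclideanLin (A - Φ) x‖ ≤ relPert A Φ t * √(1 + ric A t) * ‖x‖ := by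
  have hne : specNormCols A t ≠ 0 := by
    intro h0
    set z : EuclideanSpace ℂ (Fin d) := EuclideanSpace.single 0 1 with hz
    have hzs : (supp z).card ≤ t := by
      refine (Finset.card_le_card (t := {0}) (supp_subset_iff.2 fun i hi => ?_)).trans (by simpa)
      rw [Finset.mem_singleton] at hi
      simp [hz, hi]
    have h1 := norm_le_specNormCols A hzs
    have h2 := (rip_ric A t).le_norm hzs
    have h3 : 0 < √(1 - ric A t) := Real.sqrt_pos.2 (by linarith)
    rw [h0, zero_mul] at h1
    have h4 : ‖z‖ = 1 := by simp [hz]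
    rw [h4] at h2
    linarith
  have h1 : specNormCols A t ≤ √(1 + ric A t) :=
    specNormCols_le (Real.sqrt_nonneg _) fun _ hz => (rip_ric A t).norm_le hz
  calc ‖Matrix.toEuclideanLin (A - Φ) x‖ ≤ specNormCols (A - Φ) t * ‖x‖ :=
        norm_le_specNormCols _ hx
    _ = relPert A Φ t * specNormCols A t * ‖x‖ := by rw [relPert, div_mul_cancel₀ _ hne]
    _ ≤ _ := by
      have := relPert_nonneg A Φ t
      gcongr

/-- The restricted isometry property survives small relative perturbations. -/
theorem rip_of_relPert [NeZero d] (ht : 1 ≤ t)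
    (h : ric A t ≤ 1.1 / (1 + relPert A Φ t) ^ 2 - 1) : RIP Φ t 0.1 := by
  intro x hx
  have hδ := ric_le_of_relPert h
  have hδ0 := ric_nonneg A t
  have hd := norm_sub_apply_le_relPert (Φ := Φ) ht (by linarith) hx
  have hε := relPert_nonneg A Φ t
  have hu := (rip_ric A t).norm_le hx
  have hl := (rip_ric A t).le_norm hx
  set ε := relPert A Φ t
  set δ := ric A t
  have hp : √(1 + δ) ^ 2 = 1 + δ := Real.sq_sqrt (by linarith)
  have hq : √(1 - δ) ^ 2 = 1 - δ := Real.sq_sqrt (by linarith)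
  have hqp : √(1 - δ) ≤ √(1 + δ) := Real.sqrt_le_sqrt (by linarith)
  have hp0 := Real.sqrt_nonneg (1 + δ)
  have hq9 : 0.9 ≤ √(1 - δ) := Real.le_sqrt_of_sq_le (by norm_num; linarith)
  have hp1 : 1 ≤ √(1 + δ) := Real.le_sqrt_of_sq_le (by linarith)
  set p := √(1 + δ)
  set q := √(1 - δ)
  have hpe : (p * (1 + ε)) ^ 2 ≤ 1.1 := by
    rw [mul_pow, hp, ← le_div_iff₀ (by positivity)]
    linarith
  have hpe' : p * (1 + ε) ≤ 1.1 := by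
    refine (abs_le_of_sq_le_sq' ?_ (by norm_num)).2
    norm_num at hpe ⊢
    linarith
  have hqe : 0 ≤ q - ε * p := by nlinarith
  rw [toEuclideanLin_sub_apply] at hd
  have h1 : ‖Matrix.toEuclideanLin Φ x‖ ≤ p * (1 + ε) * ‖x‖ := by
    have := norm_sub_norm_le (Matrix.toEuclideanLin Φ x) (Matrix.toEuclideanLin A x)
    rw [norm_sub_rev] at this
    linarith
  have h2 : (q - ε * p) * ‖x‖ ≤ ‖Matrix.toEuclideanLin Φ x‖ := by
    have := norm_sub_norm_le (Matrix.toEuclideanLin A x) (Matrix.toEuclideanLin Φ x)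
    linarith
  -- From `p² + q² = 2` and `q ≤ p` follows `(q - εp)² ≥ 2 - (p (1 + ε))² ≥ 2 - 1.1`.
  have h3 : 0.9 ≤ (q - ε * p) ^ 2 := by
    nlinarith [mul_nonneg (mul_nonneg hε hp0) (sub_nonneg.2 hqp), sq_nonneg (ε * p)]
  have h1' := pow_le_pow_left₀ (norm_nonneg _) h1 2
  have h2' := pow_le_pow_left₀ (by positivity) h2 2
  rw [mul_pow] at h1' h2'
  constructor
  · refine le_trans ?_ h2'
    gcongr
    linarith
  · refine h1'.trans ?_
    gcongr
    linarith

end Perturbation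

/-! ### Energy bound for non-sparse vectors -/

section Energy

variable {m d s : ℕ} {A : Matrix (Fin m) (Fin d) ℂ} {δ : ℝ}

theorem l1Norm_nonneg (x : EuclideanSpace ℂ (Fin d)) : 0 ≤ l1Norm x :=
  Finset.sum_nonneg fun _ _ => norm_nonneg _

theorem l1Norm_restr (S : Finset (Fin d)) (x : EuclideanSpace ℂ (Fin d)) :
    l1Norm (restr S x) = ∑ i ∈ S, ‖x i‖ := by
  rw [l1Norm, ← Finset.sum_subset (Finset.subset_univ S)]
  · exact Finset.sum_congr rfl fun i hi => by rw [restr_of_mem x hi]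
  · intro i _ hi
    rw [restr_of_notMem x hi, norm_zero]

/-- Peel off the `s` largest entries `S` and induct on the tail. Tail entries are at most the
average `ν` over `S`, so any `s` of them have norm at most `√s ν`, which is the share of `S` in
`l1Norm x / √s`. Keeping `‖restr S x‖` rather than `‖x‖` in the bound is what makes the blocks
telescope. -/
theorem RIP.exists_norm_le_restr (h : RIP A s δ) (hs : 1 ≤ s) (x : EuclideanSpace ℂ (Fin d)) :
    ∃ S : Finset (Fin d), S.card ≤ s ∧
      ‖Matrix.toEuclideanLin A x‖ ≤ √(1 + δ) * (‖restr S x‖ + l1Norm x / √(s : ℝ)) := by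
  induction hn : (supp x).card using Nat.strong_induction_on generalizing x with
  | _ n ih =>
  subst hn
  have hs0 : (0 : ℝ) < s := by exact_mod_cast hs
  have hss : 0 < √(s : ℝ) := Real.sqrt_pos.2 hs0
  have hc := Real.sqrt_nonneg (1 + δ)
  rcases le_or_gt (supp x).card s with hle | hlt
  · refine ⟨supp x, hle, ?_⟩
    rw [restr_eq_self subset_rfl]
    refine (h.norm_le hle).trans ?_
    gcongr
    have := div_nonneg (l1Norm_nonneg x) hss.le
    linarith
  obtain ⟨S, hS, hdom⟩ := exists_dominating (fun i => ‖x i‖) s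
    (hlt.le.trans (Finset.card_le_univ _))
  obtain ⟨j, hj, hjS⟩ := Finset.exists_mem_notMem_of_card_lt_card (hS.trans_lt hlt)
  obtain ⟨i, hi⟩ : S.Nonempty := Finset.card_pos.1 (by omega)
  have hsub : supp (restr Sᶜ x) ⊂ supp x := by
    refine (Finset.ssubset_iff_of_subset ?_).2 ⟨i, ?_, ?_⟩
    · rw [supp_subset_iff]
      intro l hl
      have : x l = 0 := by simpa [mem_supp] using hl
      simp [restr_apply, this]
    · have := hdom i hi j hjS
      rw [mem_supp] at hj ⊢
      exact norm_pos_iff.1 ((norm_pos_iff.2 hj).trans_le this)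
    · simp [mem_supp, restr_apply, hi]
  obtain ⟨S', hS', hb⟩ := ih _ (Finset.card_lt_card hsub) (restr Sᶜ x) rfl
  refine ⟨S, hS.le, ?_⟩
  set ν : ℝ := (∑ i ∈ S, ‖x i‖) / s with hν
  have hν0 : 0 ≤ ν := div_nonneg (Finset.sum_nonneg fun _ _ => norm_nonneg _) hs0.le
  have hentry : ∀ l, ‖restr Sᶜ x l‖ ≤ ν := by
    intro l
    by_cases hl : l ∈ S
    · simpa [restr_apply, hl] using hν0
    · rw [restr_of_mem x (Finset.mem_compl.2 hl), hν, le_div_iff₀ hs0, mul_comm]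
      have := Finset.card_nsmul_le_sum S (fun i => ‖x i‖) ‖x l‖ fun i hi => hdom i hi l hl
      rwa [hS, nsmul_eq_mul] at this
  have htail : ‖restr S' (restr Sᶜ x)‖ ≤ √(s : ℝ) * ν := by
    refine (abs_le_of_sq_le_sq' ?_ (by positivity)).2
    rw [norm_sq_restr, mul_pow, Real.sq_sqrt hs0.le]
    calc ∑ i ∈ S', ‖restr Sᶜ x i‖ ^ 2 ≤ S'.card • ν ^ 2 :=
          Finset.sum_le_card_nsmul _ _ _ fun i _ =>
            pow_le_pow_left₀ (norm_nonneg _) (hentry i) 2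
      _ ≤ s * ν ^ 2 := by
        rw [nsmul_eq_mul]
        gcongr
  have hsν : √(s : ℝ) * ν = (∑ i ∈ S, ‖x i‖) / √(s : ℝ) := by
    rw [hν, eq_div_iff hss.ne']
    have := Real.mul_self_sqrt hs0.le
    field_simp
    linear_combination (∑ i ∈ S, ‖x i‖) * this
  have hl1 : l1Norm x = ∑ i ∈ S, ‖x i‖ + l1Norm (restr Sᶜ x) := by
    rw [l1Norm_restr, l1Norm, Finset.sum_add_sum_compl]
  have hhead := h.norm_le ((Finset.card_le_card (supp_restr_subset S x)).trans hS.le)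
  calc ‖Matrix.toEuclideanLin A x‖
      = ‖Matrix.toEuclideanLin A (restr S x) + Matrix.toEuclideanLin A (restr Sᶜ x)‖ := by
        rw [← map_add, restr_add_restr_compl]
    _ ≤ √(1 + δ) * ‖restr S x‖ +
        √(1 + δ) * (√(s : ℝ) * ν + l1Norm (restr Sᶜ x) / √(s : ℝ)) := by
      refine (norm_add_le _ _).trans (add_le_add hhead (hb.trans ?_))
      gcongr
    _ = _ := by rw [hsν, hl1]; ring

/-- The energy bound for vectors which need not be sparse. -/
theorem RIP.norm_le_add_l1Norm (h : RIP A s δ) (hs : 1 ≤ s) (x : EuclideanSpace ℂ (Fin d)) :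
    ‖Matrix.toEuclideanLin A x‖ ≤ √(1 + δ) * (‖x‖ + l1Norm x / √(s : ℝ)) := by
  obtain ⟨S, -, hb⟩ := h.exists_norm_le_restr hs x
  refine hb.trans ?_
  gcongr
  exact norm_restr_le S x

end Energy

/-! ### Analysis of the CoSaMP iteration -/

section Step

variable {m d s : ℕ} {Φ : Matrix (Fin m) (Fin d) ℂ}

theorem abs_re_inner_le {n : ℕ} (x y : EuclideanSpace ℂ (Fin n)) :
    |(inner ℂ x y).re| ≤ ‖x‖ * ‖y‖ :=
  (Complex.abs_re_le_norm _).trans (norm_inner_le_norm x y)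

/-- The error of the least-squares estimate is controlled by the missed coordinates. -/
theorem IsEstimate.norm_sub_le (hΦ : RIP Φ (4 * s) 0.1) {x w : EuclideanSpace ℂ (Fin d)}
    {e : EuclideanSpace ℂ (Fin m)} {T : Finset (Fin d)}
    (h : IsEstimate Φ (Matrix.toEuclideanLin Φ x + e) T w) (hT : (supp x ∪ T).card ≤ 4 * s) :
    ‖x - w‖ ≤ 10 / 9 * ‖restr Tᶜ x‖ + 7 / 6 * ‖e‖ := by
  have hw : supp w ⊆ T := supp_subset_iff.2 h.2
  have hT' : supp (restr T (x - w)) ⊆ T := supp_restr_subset _ _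
  have hsub : supp (x - w) ⊆ supp x ∪ T :=
    (supp_sub_subset x w).trans (Finset.union_subset_union subset_rfl hw)
  have hc : (supp (restr T (x - w)) ∪ supp (x - w)).card ≤ 4 * s :=
    (Finset.card_le_card
      (Finset.union_subset (hT'.trans Finset.subset_union_right) hsub)).trans hT
  -- Test the orthogonality of the residual against the error on `T`. The sign change gives the
  -- other side of the one-sided inner product bound.
  have h1 := hΦ.re_inner_sub_le (x := -restr T (x - w)) (y := x - w) (by rwa [supp_neg])
  have h1' := hΦ.norm_le ((Finset.card_le_card Finset.subset_union_left).trans hc)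
  have h2 := h.inner_residual hT'
  have h3 : Matrix.toEuclideanLin Φ x + e - Matrix.toEuclideanLin Φ w =
      Matrix.toEuclideanLin Φ (x - w) + e := by rw [map_sub]; abel
  rw [h3, inner_add_right] at h2
  have h4 := congrArg Complex.re h2
  have h5 := (abs_le.1 (abs_re_inner_le (Matrix.toEuclideanLin Φ (restr T (x - w))) e)).1
  rw [map_neg, inner_neg_left, inner_neg_left, inner_restr_left, norm_neg] at h1
  simp only [Complex.add_re, Complex.neg_re, Complex.zero_re, Complex.ofReal_re] at h1 h4
  have hsq : √(1 + 0.1 : ℝ) ≤ 1.05 := Real.sqrt_le_iff.2 (by norm_num)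
  have h6 : ‖restr Tᶜ (x - w)‖ = ‖restr Tᶜ x‖ := by
    congr 1
    ext i
    by_cases hi : i ∈ T
    · simp [restr_apply, hi]
    · simp [restr_apply, h.2 i hi]
  have h7 := norm_add_le (restr T (x - w)) (restr Tᶜ (x - w))
  rw [restr_add_restr_compl, h6] at h7
  -- Absorbing `0.1 * ‖x - w‖` on the left leaves the factor `0.9`, hence `10 / 9` and `1.05 / 0.9 =
  -- 7 / 6`.
  have h8 : ‖restr T (x - w)‖ ≤ 1.05 * ‖e‖ + 0.1 * ‖x - w‖ := by
    rcases (norm_nonneg (restr T (x - w))).eq_or_lt with h0 | h0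
    · rw [← h0]; positivity
    refine le_of_mul_le_mul_left ?_ h0
    have h9 : ‖Matrix.toEuclideanLin Φ (restr T (x - w))‖ * ‖e‖ ≤
        1.05 * ‖restr T (x - w)‖ * ‖e‖ := by
      gcongr
      exact h1'.trans (by gcongr)
    nlinarith
  linarith

/-- Most of the residual is found among the largest coordinates of the proxy. -/
theorem norm_restr_compl_le_of_isLargestPart (hΦ : RIP Φ (4 * s) 0.1)
    {r u' : EuclideanSpace ℂ (Fin d)} {e : EuclideanSpace ℂ (Fin m)}
    (hr : (supp r).card ≤ 2 * s)
    (hu : IsLargestPart (2 * s)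
      (Matrix.toEuclideanLin Φᴴ (Matrix.toEuclideanLin Φ r + e)) u') :
    ‖restr (supp u')ᶜ r‖ ≤ 0.2 * ‖r‖ + 2.1 * ‖e‖ := by
  set u := Matrix.toEuclideanLin Φᴴ (Matrix.toEuclideanLin Φ r + e) with hu_def
  set R := supp r
  set Ω := supp u'
  have hinner : ∀ z : EuclideanSpace ℂ (Fin d), (inner ℂ z u).re =
      (inner ℂ (Matrix.toEuclideanLin Φ z) (Matrix.toEuclideanLin Φ r)).re +
        (inner ℂ (Matrix.toEuclideanLin Φ z) e).re := by
    intro z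
    rw [hu_def, ← inner_toEuclideanLin_left, inner_add_right, Complex.add_re]
  have hΩ : Ω.card ≤ 2 * s := hu.card_supp_le
  have hsq : √(1 + 0.1 : ℝ) ≤ 1.05 := Real.sqrt_le_iff.2 (by norm_num)
  -- `R` has at most `2s` elements, so `Ω` carries at least as much of `u`; cancel `R ∩ Ω`.
  have hcmp : ‖restr (R \ Ω) u‖ ≤ ‖restr (Ω \ R) u‖ := by
    refine (abs_le_of_sq_le_sq' ?_ (norm_nonneg _)).2
    have h1 := hu.sum_le hr
    rw [hu.eq_restr, norm_sq_restr, ← Finset.sum_sdiff (Finset.inter_subset_left : R ∩ Ω ⊆ R),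
      ← Finset.sum_sdiff (Finset.inter_subset_left : Ω ∩ R ⊆ Ω), Finset.sdiff_inter_self_left,
      Finset.sdiff_inter_self_left, Finset.inter_comm Ω R] at h1
    rw [norm_sq_restr, norm_sq_restr]
    linarith
  have hcard : ∀ {z : EuclideanSpace ℂ (Fin d)}, supp z ⊆ R ∪ Ω →
      (supp z).card ≤ 4 * s ∧ (supp z ∪ supp r).card ≤ 4 * s := by
    intro z hz
    have h1 : (R ∪ Ω).card ≤ 4 * s := (Finset.card_union_le _ _).trans (by omega)
    exact ⟨(Finset.card_le_card hz).trans h1, (Finset.card_le_card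
      (Finset.union_subset hz Finset.subset_union_left)).trans h1⟩
  have hnoise : ∀ {z : EuclideanSpace ℂ (Fin d)}, supp z ⊆ R ∪ Ω →
      |(inner ℂ (Matrix.toEuclideanLin Φ z) e).re| ≤ ‖z‖ * (1.05 * ‖e‖) := by
    intro z hz
    refine (abs_re_inner_le _ _).trans ?_
    have h1 := hΦ.norm_le (hcard hz).1
    calc _ ≤ 1.05 * ‖z‖ * ‖e‖ := by
          gcongr
          exact h1.trans (by gcongr)
      _ = _ := by ring
  -- Off the support of `r` the proxy consists only of cross-correlation and noise.
  have hupper : ‖restr (Ω \ R) u‖ ≤ 0.1 * ‖r‖ + 1.05 * ‖e‖ := by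
    rcases (norm_nonneg (restr (Ω \ R) u)).eq_or_lt with h0 | h0
    · rw [← h0]; positivity
    refine le_of_mul_le_mul_left ?_ h0
    have hs : supp (restr (Ω \ R) u) ⊆ R ∪ Ω :=
      (supp_restr_subset _ _).trans (Finset.sdiff_subset.trans Finset.subset_union_right)
    have h1 := hinner (restr (Ω \ R) u)
    rw [inner_restr_left, Complex.ofReal_re] at h1
    have h2 := hΦ.re_inner_sub_le (hcard hs).2
    have h3 : inner ℂ (restr (Ω \ R) u) r = 0 := by
      refine inner_eq_zero_of_disjoint fun i => ?_
      by_cases hi : i ∈ R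
      · left; simp [restr_apply, hi]
      · exact Or.inr (supp_subset_iff.1 subset_rfl i hi)
    rw [h3, Complex.zero_re] at h2
    have h4 := (abs_le.1 (hnoise hs)).2
    nlinarith
  have hz : restr Ωᶜ r = restr (R \ Ω) r := by
    ext i
    by_cases hi : i ∈ R
    · simp [restr_apply, hi]
    · have : r i = 0 := supp_subset_iff.1 subset_rfl i hi
      simp [restr_apply, this]
  -- On the missed coordinates the proxy is close to `r` itself.
  have hlower : ‖restr (R \ Ω) r‖ ≤ ‖restr (R \ Ω) u‖ + 0.1 * ‖r‖ + 1.05 * ‖e‖ := by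
    rcases (norm_nonneg (restr (R \ Ω) r)).eq_or_lt with h0 | h0
    · rw [← h0]; positivity
    refine le_of_mul_le_mul_left ?_ h0
    have hs : supp (restr (R \ Ω) r) ⊆ R ∪ Ω :=
      (supp_restr_subset _ _).trans (Finset.sdiff_subset.trans Finset.subset_union_left)
    have h1 := hinner (restr (R \ Ω) r)
    have h2 := hΦ.re_inner_sub_le (x := -restr (R \ Ω) r) (y := r) (by
      rw [supp_neg]
      exact (hcard hs).2)
    rw [map_neg, inner_neg_left, inner_neg_left, inner_restr_left, norm_neg, Complex.neg_re,
      Complex.neg_re, Complex.ofReal_re] at h2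
    have h3 : inner ℂ (restr (R \ Ω) r) u = inner ℂ (restr (R \ Ω) r) (restr (R \ Ω) u) := by
      simp only [PiLp.inner_apply]
      refine Finset.sum_congr rfl fun i _ => ?_
      by_cases h : i ∈ R \ Ω
      · rw [restr_of_mem _ h, restr_of_mem _ h]
      · rw [restr_of_notMem _ h, inner_zero_left, inner_zero_left]
    have h4 := (abs_le.1 (abs_re_inner_le (restr (R \ Ω) r) (restr (R \ Ω) u))).2
    rw [← h3] at h4
    have h5 := (abs_le.1 (hnoise hs)).1
    nlinarith
  rw [hz]
  linarith

/-- One iteration of CoSaMP: the set `T` of merged supports misses little of the target, and the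
new error is controlled by what it misses. -/
theorem IsStep.exists_bounds (hΦ : RIP Φ (4 * s) 0.1) {x a a' : EuclideanSpace ℂ (Fin d)}
    {e : EuclideanSpace ℂ (Fin m)} (hx : (supp x).card ≤ s) (ha : (supp a).card ≤ s)
    (h : IsStep Φ (Matrix.toEuclideanLin Φ x + e) s a a') :
    ∃ T : Finset (Fin d), ‖restr Tᶜ x‖ ≤ 0.2 * ‖x - a‖ + 2.1 * ‖e‖ ∧
      ‖x - a'‖ ≤ 20 / 9 * ‖restr Tᶜ x‖ + 7 / 3 * ‖e‖ := by
  obtain ⟨v, u, u', w, rfl, rfl, hu, hw, ha'⟩ := h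
  refine ⟨supp u' ∪ supp a, ?_, ?_⟩
  · have h1 : Matrix.toEuclideanLin Φ x + e - Matrix.toEuclideanLin Φ a =
        Matrix.toEuclideanLin Φ (x - a) + e := by rw [map_sub]; abel
    rw [h1] at hu
    have hr : (supp (x - a)).card ≤ 2 * s :=
      (Finset.card_le_card (supp_sub_subset x a)).trans
        ((Finset.card_union_le _ _).trans (by omega))
    refine le_trans ?_ (norm_restr_compl_le_of_isLargestPart hΦ hr hu)
    have h2 : restr (supp u' ∪ supp a)ᶜ x =
        restr (supp u' ∪ supp a)ᶜ (restr (supp u')ᶜ (x - a)) := by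
      ext i
      by_cases hi : i ∈ supp u' ∪ supp a
      · have hi' := fun h => Finset.mem_compl.1 h hi
        rw [restr_of_notMem _ hi', restr_of_notMem _ hi']
      · have hi' := hi
        simp only [Finset.mem_union, not_or] at hi'
        have : a i = 0 := by simpa [mem_supp] using hi'.2
        simp [restr_apply, hi'.1, this]
    rw [h2]
    exact norm_restr_le _ _
  · have hu' := hu.card_supp_le
    -- The order `4s` arises here as `s + 2s + s`.
    have hT : (supp x ∪ (supp u' ∪ supp a)).card ≤ 4 * s := by
      have h1 := Finset.card_union_le (supp x) (supp u' ∪ supp a)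
      have h2 := Finset.card_union_le (supp u') (supp a)
      omega
    have h1 := hw.norm_sub_le hΦ hT
    -- `x` competes with `a'` as an `s`-sparse approximation of `w`, so pruning at most doubles the
    -- error.
    have h2 := ha'.norm_sub_le hx
    have h3 := norm_sub_le_norm_sub_add_norm_sub x w a'
    rw [norm_sub_rev w x] at h2
    linarith

/-- CoSaMP recovers sparse vectors up to the noise level, after a number of iterations that
depends only on the sparsity: the missed part of the target is one of at most `2 ^ s` vectors, and
its norm decreases until it reaches the noise level. -/
theorem IsRun.norm_sub_le (hΦ : RIP Φ (4 * s) 0.1) {x : EuclideanSpace ℂ (Fin d)}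
    {e : EuclideanSpace ℂ (Fin m)} (hx : (supp x).card ≤ s) {a : ℕ → EuclideanSpace ℂ (Fin d)}
    (h : IsRun Φ (Matrix.toEuclideanLin Φ x + e) s a) {k : ℕ} (hk : 2 ^ s + 1 ≤ k) :
    ‖x - a k‖ ≤ 30 * ‖e‖ := by
  have hsp : ∀ k, (supp (a k)).card ≤ s := by
    rintro (_ | k)
    · rw [h.1]
      simp [supp]
    · obtain ⟨v, u, u', w, -, -, -, -, ha⟩ := h.2 k
      exact ha.card_supp_le
  choose T hT1 hT2 using fun k => (h.2 k).exists_bounds hΦ hx (hsp k)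
  -- The error of iterate `j + 1` is governed by the set chosen in step `j`, hence the extra
  -- iteration beyond `2 ^ s`.
  obtain ⟨k, rfl⟩ : ∃ j, k = j + 1 :=
    ⟨k - 1, (Nat.sub_add_cancel (le_trans (Nat.le_add_left _ _) hk)).symm⟩
  have he := norm_nonneg e
  -- Composing the two bounds gives the factor `0.2 · 20/9 < 1/2` and noise `0.2 · 7/3 + 2.1 < 3`.
  have hmiss : ‖restr (T k)ᶜ x‖ ≤ 4 * (3 * ‖e‖) := by
    refine le_of_contract_of_finite_range (M := fun k => ‖restr (T k)ᶜ x‖) (by positivity)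
      (fun k => ?_) ((supp x).powerset.image fun R => ‖restr R x‖) (fun k => ?_) (n := 2 ^ s)
      ?_ (Nat.le_of_succ_le_succ hk)
    · have := norm_nonneg (restr (T k)ᶜ x)
      linarith [hT1 (k + 1), hT2 k]
    · refine Finset.mem_image.2 ⟨supp x \ T k, Finset.mem_powerset.2 Finset.sdiff_subset, ?_⟩
      congr 1
      ext i
      by_cases hi : i ∈ supp x
      · simp [restr_apply, hi]
      · have : x i = 0 := supp_subset_iff.1 subset_rfl i hi
        simp [restr_apply, this]
    · refine Finset.card_image_le.trans ?_
      rw [Finset.card_powerset]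
      exact Nat.pow_le_pow_right two_pos hx
  linarith [hT2 k]

end Step

/-! ### Lower bound for the samples -/

section Samples

variable {m d s : ℕ} {A : Matrix (Fin m) (Fin d) ℂ} {x xs : EuclideanSpace ℂ (Fin d)}

/-- For nearly sparse vectors the samples control the norm of the largest part. -/
theorem norm_largestPart_le (hs : 1 ≤ s) (hA : ric A s ≤ 0.1) (hxs : IsLargestPart s x xs)
    (h : alpha x xs + beta s x xs ≤ 1 / (2 * kappa A s)) :
    ‖xs‖ ≤ 2.2 * ‖Matrix.toEuclideanLin A x‖ := by
  rcases (norm_nonneg xs).eq_or_lt with h0 | h0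
  · rw [← h0]; positivity
  have hδ0 := ric_nonneg A s
  have hss : 0 < √(s : ℝ) := Real.sqrt_pos.2 (by exact_mod_cast hs)
  have hl := (rip_ric A s).le_norm hxs.card_supp_le
  have hu := (rip_ric A s).norm_le_add_l1Norm hs (x - xs)
  have hq : 0.94 ≤ √(1 - ric A s) := Real.le_sqrt_of_sq_le (by norm_num; linarith)
  have hp : 0 < √(1 + ric A s) := Real.sqrt_pos.2 (by linarith)
  rw [kappa] at h
  set p := √(1 + ric A s)
  set q := √(1 - ric A s)
  have hab : ‖x - xs‖ + l1Norm (x - xs) / √(s : ℝ) = (alpha x xs + beta s x xs) * ‖xs‖ := by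
    rw [alpha, beta]
    field_simp
  have hκ : 1 / (2 * (p / q)) = q / (2 * p) := by field_simp
  rw [hκ, le_div_iff₀ (by positivity)] at h
  rw [hab] at hu
  -- The tail costs at most half of the lower bound `q * ‖xs‖`; the remaining `q / 2 ≥ 0.47` gives
  -- `2.2`.
  have h1 : ‖Matrix.toEuclideanLin A (x - xs)‖ ≤ q / 2 * ‖xs‖ := by
    nlinarith
  have h2 := norm_sub_le (Matrix.toEuclideanLin A x) (Matrix.toEuclideanLin A (x - xs))
  rw [← map_sub, sub_sub_cancel] at h2
  nlinarith

end Samples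

end MixedCoSaMP

/-! ### Assembly of the error bound -/

open MixedCoSaMP in
theorem theorem2p2 :
    ∃ C : ℝ, 0 < C ∧ ∃ N : ℕ → ℕ,
      ∀ (m d s : ℕ), 1 ≤ s →
      ∀ (A Φ : Matrix (Fin m) (Fin d) ℂ)
        (x xs : EuclideanSpace ℂ (Fin d)) (b e y : EuclideanSpace ℂ (Fin m)),
        ric A (4 * s) ≤ 1.1 / (1 + relPert A Φ (4 * s)) ^ 2 - 1 →
        IsLargestPart s x xs →
        alpha x xs + beta s x xs ≤ 1 / (2 * kappa A s) →
        b = Matrix.toEuclideanLin A x →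
        y = b + e →
        ∀ a : ℕ → EuclideanSpace ℂ (Fin d), IsRun Φ y s a →
          ∀ k, N s ≤ k →
            ‖a k - x‖ ≤ C * (‖x - xs‖ + 1 / √(s : ℝ) * l1Norm (x - xs)
              + (specNorm (A - Φ) * alpha x xs + specNormCols (A - Φ) s) * ‖b‖ + ‖e‖) := by
  -- The largest coefficient is `30 · 2.2 = 66`, on the perturbation term; the tail needs `30 · 1.05
  -- + 1`.
  refine ⟨70, by norm_num, fun s => 2 ^ s + 1, ?_⟩
  rintro m d s hs A Φ x xs b e y hric hxs hαβ rfl rfl a ha k hk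
  have hα : 0 ≤ alpha x xs := div_nonneg (norm_nonneg _) (norm_nonneg _)
  have hl1 := l1Norm_nonneg (x - xs)
  have hG := specNorm_nonneg (A - Φ)
  have hGs := specNormCols_nonneg (A - Φ) s
  rcases d.eq_zero_or_pos with rfl | hd
  · rw [Subsingleton.elim (a k - x) 0, norm_zero]
    positivity
  have : NeZero d := ⟨hd.ne'⟩
  have hA : ric A s ≤ 0.1 := (ric_mono A (by omega)).trans (ric_le_of_relPert hric)
  have hxb := norm_largestPart_le hs hA hxs hαβ
  set e' := Matrix.toEuclideanLin A (x - xs) + Matrix.toEuclideanLin (A - Φ) xs + e with he'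
  have hy : Matrix.toEuclideanLin A x + e = Matrix.toEuclideanLin Φ xs + e' := by
    rw [he', toEuclideanLin_sub_apply, map_sub]
    abel
  rw [hy] at ha
  have hrun := ha.norm_sub_le (rip_of_relPert (by omega) hric) hxs.card_supp_le hk
  have hn : ‖e'‖ ≤ 1.05 * (‖x - xs‖ + l1Norm (x - xs) / √(s : ℝ)) +
      2.2 * (specNormCols (A - Φ) s * ‖Matrix.toEuclideanLin A x‖) + ‖e‖ := by
    refine (norm_add₃_le).trans (add_le_add_left (add_le_add ?_ ?_) _)
    · refine ((rip_ric A s).norm_le_add_l1Norm hs (x - xs)).trans ?_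
      gcongr
      exact Real.sqrt_le_iff.2 ⟨by norm_num, by norm_num; linarith⟩
    · calc _ ≤ specNormCols (A - Φ) s * ‖xs‖ := norm_le_specNormCols _ hxs.card_supp_le
        _ ≤ specNormCols (A - Φ) s * (2.2 * ‖Matrix.toEuclideanLin A x‖) := by gcongr
        _ = _ := by ring
  have htri : ‖a k - x‖ ≤ ‖xs - a k‖ + ‖x - xs‖ := by
    have := norm_sub_le_norm_sub_add_norm_sub (a k) xs x
    rwa [norm_sub_rev (a k) xs, norm_sub_rev xs x] at this
  -- Only the sign of the `α_s` term matters: `Φ` is applied to `xs` alone, so the tail never meets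
  -- `A - Φ`.
  have h1 : 0 ≤ specNorm (A - Φ) * alpha x xs * ‖Matrix.toEuclideanLin A x‖ := by positivity
  have h2 : 0 ≤ specNormCols (A - Φ) s * ‖Matrix.toEuclideanLin A x‖ := by positivity
  have h3 : 0 ≤ l1Norm (x - xs) / √(s : ℝ) := by positivity
  have h4 : 1 / √(s : ℝ) * l1Norm (x - xs) = l1Norm (x - xs) / √(s : ℝ) := by ring
  rw [h4, add_mul]
  have h5 := norm_nonneg (x - xs)
  have h6 := norm_nonneg e
  linarith
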